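/- **Theorem (Unimodularity Theorem).** Let $n\ge 0$ and let $\mathcal D\subset\mathbb Z^n$ be a (finite or infinite) set of primitive integer vectors, i.e. vectors whose entries have greatest common divisor $1$. *Definitions.* A utility function is a function $u:A\to\mathbb R$ on a finite set $A\subset\mathbb Z^n$. For $x\in\mathbb R^n$ its cell at $x$ is the set of $a\in A$ that maximize $u(a)+a\cdot x$; the collection $\Delta_u$ of all cells is the regular subdivision of $A$ induced by $u$, and its edges are the cells whose affine span is one-dimensional. The function $u$ is concave if $A=\operatorname{conv}(A)\cap\mathbb Z^n$ and every $a\in A$ lies in some cell; it is of demand type $\mathcal D$ if every edge of $\Delta_u$ is parallel to a vector in $\mathcal D$. For $p\in\mathbb R^n$ the demand set $D_u(p)$ is the set of $a\in A$ that maximize $u(a)-p\cdot a$. Given $u^j:A^j\to\mathbb R$, $j=1,\dots,J$, put $A=A^1+\dots+A^J$ (Minkowski sum) and $D_U(p)=D_{u^1}(p)+\dots+D_{u^J}(p)$; the collection $\{u^j\}$ has a competitive equilibrium if for every $a\in\operatorname{conv}(A)\cap\mathbb Z^n$ there is a price $p\in\mathbb R^n$ with $a\in D_U(p)$. The set $\mathcal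 D$ is unimodular if every linearly independent subset $S\subset\mathcal D$ (of any size) spans over $\mathbb Z$ the lattice $\operatorname{span}_{\mathbb R}(S)\cap\mathbb Z^n$. *Claim.* The set $\mathcal D$ is unimodular if and only if every finite collection $\{u^j: j=1,\dots,J\}$ of concave utility functions of demand type $\mathcal D$ has a competitive equilibrium. In particular, if $\mathcal D$ spans $\mathbb R^n$, then every linearly independent subset of $n$ vectors in $\mathcal D$ spans $\mathbb Z^n$ over $\mathbb Z$ if and only if every such collection has a competitive equilibrium. -/

import Mathlib

namespace ProductMix

/-- The real vector underlying an integer vector. -/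
def toReal {n : ℕ} (a : Fin n → ℤ) : Fin n → ℝ := fun i => (a i : ℝ)

/-- A utility function `u : A → ℝ` on a finite set `A ⊂ ℤⁿ` of bundles. Only the values of `value`
at points of `bundles` are ever used. -/
structure Utility (n : ℕ) where
  /-- the domain `A` -/
  bundles : Finset (Fin n → ℤ)
  /-- the bid `u a` for the bundle `a ∈ A` -/
  value : (Fin n → ℤ) → ℝ

/-- The demand set at the price `p`: the bundles `a ∈ A` that maximize the profit `u a - p · a`. -/
def Utility.demand {n : ℕ} (u : Utility n) (p : Fin n → ℝ) : Set (Fin n → ℤ) :=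
  {a | a ∈ u.bundles ∧
    ∀ b ∈ u.bundles, u.value b - p ⬝ᵥ toReal b ≤ u.value a - p ⬝ᵥ toReal a}

/-- The cell of the regular subdivision selected by `x`: the bundles `a ∈ A` at which the maximum in
the tropical polynomial `f_u(x) = max {u a + a · x : a ∈ A}` is attained. -/
def Utility.cell {n : ℕ} (u : Utility n) (x : Fin n → ℝ) : Set (Fin n → ℤ) :=
  {a | a ∈ u.bundles ∧
    ∀ b ∈ u.bundles, u.value b + toReal b ⬝ᵥ x ≤ u.value a + toReal a ⬝ᵥ x}

/-- The regular subdivision `Δ_u` of `A` induced by `u`: the collection of its cells (of all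
dimensions). -/
def Utility.subdivision {n : ℕ} (u : Utility n) : Set (Set (Fin n → ℤ)) :=
  Set.range u.cell

/-- The direction space of a set of lattice points: the linear subspace of `ℝⁿ` parallel to its
affine span. -/
def direction {n : ℕ} (σ : Set (Fin n → ℤ)) : Submodule ℝ (Fin n → ℝ) :=
  vectorSpan ℝ (toReal '' σ)

/-- The edges of the regular subdivision: its one-dimensional cells. -/
def Utility.edges {n : ℕ} (u : Utility n) : Set (Set (Fin n → ℤ)) :=
  {σ | σ ∈ u.subdivision ∧ Module.finrank ℝ (direction σ) = 1}

/-- `u` is concave: `A` contains all the integer points of its convex hull, and for each `a ∈ A`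
there is an `x` such that the maximum in `f_u(x)` is attained (perhaps not uniquely) at `a`. -/
def Utility.IsConcave {n : ℕ} (u : Utility n) : Prop :=
  (∀ a : Fin n → ℤ, toReal a ∈ convexHull ℝ (toReal '' (u.bundles : Set (Fin n → ℤ))) →
    a ∈ u.bundles) ∧
  ∀ a ∈ u.bundles, ∃ x : Fin n → ℝ, a ∈ u.cell x

/-- `u` is of demand type `D`: every edge of `Δ_u` is parallel to a vector in `D`. -/
def Utility.IsOfDemandType {n : ℕ} (u : Utility n) (D : Set (Fin n → ℤ)) : Prop :=
  ∀ σ ∈ u.edges, ∃ v ∈ D, direction σ = Submodule.span ℝ {toReal v}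

/-- The Minkowski sum `A = A¹ + ⋯ + Aᴶ` of the domains. -/
def totalBundles {n J : ℕ} (u : Fin J → Utility n) : Set (Fin n → ℤ) :=
  {a | ∃ b : Fin J → (Fin n → ℤ), (∀ j, b j ∈ (u j).bundles) ∧ ∑ j, b j = a}

/-- The aggregate demand `D_U(p)`: the Minkowski sum of the demand sets of the agents. -/
def aggregateDemand {n J : ℕ} (u : Fin J → Utility n) (p : Fin n → ℝ) : Set (Fin n → ℤ) :=
  {a | ∃ b : Fin J → (Fin n → ℤ), (∀ j, b j ∈ (u j).demand p) ∧ ∑ j, b j = a}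

/-- Competitive equilibrium exists at the supply bundle `a`. -/
def HasEquilibriumAt {n J : ℕ} (u : Fin J → Utility n) (a : Fin n → ℤ) : Prop :=
  ∃ p : Fin n → ℝ, a ∈ aggregateDemand u p

/-- Competitive equilibrium exists over `conv A`: at every lattice point of `conv A`. -/
def HasEquilibrium {n J : ℕ} (u : Fin J → Utility n) : Prop :=
  ∀ a : Fin n → ℤ, toReal a ∈ convexHull ℝ (toReal '' totalBundles u) → HasEquilibriumAt u a

/-- An integer vector is primitive if the greatest common divisor of its entries is `1`. -/
def IsPrimitive {n : ℕ} (v : Fin n → ℤ) : Prop :=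
  Finset.univ.gcd v = 1

/-- `S` is a linearly independent set of integer vectors. -/
def IsIndependent {n : ℕ} (S : Set (Fin n → ℤ)) : Prop :=
  LinearIndependent ℝ (fun v : S => toReal (v : Fin n → ℤ))

/-- `D` is unimodular: the `ℤ`-span of every linearly independent subset `S` of `D`, of any size,
contains every integer vector of the `ℝ`-span of `S` (so `S` is a basis of this lattice). -/
def IsUnimodular {n : ℕ} (D : Set (Fin n → ℤ)) : Prop :=
  ∀ S ⊆ D, IsIndependent S → ∀ w : Fin n → ℤ,
    toReal w ∈ Submodule.span ℝ (toReal '' S) → w ∈ Submodule.span ℤ S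

/-- Every linearly independent subset of `n` vectors in `D` spans `ℤⁿ` over `ℤ`. For `D` that spans
`ℝⁿ` this is the usual form of unimodularity; otherwise it holds vacuously. -/
def EveryBasisSpans {n : ℕ} (D : Set (Fin n → ℤ)) : Prop :=
  ∀ S ⊆ D, S.encard = n → IsIndependent S → Submodule.span ℤ S = ⊤

end ProductMix

open scoped Pointwise

namespace ProductMix

/-! Unimodular implies equilibrium. For a supply `a` in the convex hull, linear programming duality
gives a price at which `a = ∑ q j` with each `q j` in the convex hull of the demand set of agent `j`
(`exists_price_convexHull_demand`). Choose the decomposition to be an extreme point of the set of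
all of them. Let `L j` be the direction space of the cell having `q j` in its relative interior.
Extremality says exactly that the spaces `L j` are independent. Each `L j` is spanned by vectors of
`D`, because the edges of a cell span its direction (`Utility.direction_cell_eq_span`). Pick a
vertex `b j` in each cell: the integer vector `a - ∑ b j` lies in the real span of these vectors of
`D`, so by unimodularity it is a sum of integer vectors `w j` in `L j`. Independence forces `q j = b
j + w j`, which is integral, and concavity makes it demanded.

Conversely, let `w` be a lattice point in the real span of an independent `S ⊆ D`. Subtracting the
integer parts of its coefficients moves it into the zonotope of `S`. Equilibrium for the agents with
bundles `0` and `s`, one for each `s` in `S`, writes the result as a subset sum of `S`, so `w` is an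
integer combination of `S`. -/

/-! ### Farkas' lemma and linear programming duality -/

/-- **Farkas' lemma** for a finite family of vectors. -/
theorem farkas_finset {V ι : Type*} [AddCommGroup V] [Module ℝ V] [DecidableEq ι] (s : Finset ι) :
    ∀ (v : ι → V) (t : V),
      (∃ c : ι → ℝ, (∀ i ∈ s, 0 ≤ c i) ∧ ∑ i ∈ s, c i • v i = t) ∨
      ∃ f : Module.Dual ℝ V, (∀ i ∈ s, f (v i) ≤ 0) ∧ 0 < f t := by
  induction s using Finset.induction_on with
  | empty =>
    intro v t
    by_cases ht : t = 0
    · exact Or.inl ⟨0, by simp [ht]⟩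
    · right
      obtain ⟨f, hf⟩ : ∃ f : Module.Dual ℝ V, f t ≠ 0 := by
        by_contra! h
        exact ht ((Module.forall_dual_apply_eq_zero_iff ℝ t).1 h)
      rcases lt_or_gt_of_ne hf with h | h
      · exact ⟨-f, by simp, by simpa using h⟩
      · exact ⟨f, by simp, h⟩
  | insert a s ha ih =>
    intro v t
    rcases ih v t with ⟨c, hc, hct⟩ | ⟨f, hf, hft⟩
    · left
      refine ⟨Function.update c a 0, fun i hi => ?_, ?_⟩
      · rcases eq_or_ne i a with rfl | h
        · simp
        · simpa [h] using hc i (Finset.mem_of_mem_insert_of_ne hi h)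
      · rw [Finset.sum_insert ha, Function.update_self, zero_smul, zero_add, ← hct]
        refine Finset.sum_congr rfl fun i hi => ?_
        rw [Function.update_of_ne (ne_of_mem_of_not_mem hi ha)]
    rcases le_or_gt (f (v a)) 0 with h | h
    · right
      exact ⟨f, fun i hi => (Finset.mem_insert.1 hi).elim (fun e => e ▸ h) (hf i), hft⟩
    -- Now `f` is positive on `v a`: project everything along `v a` onto the kernel of `f` and use
    -- induction there.
    rcases ih (fun i => v i - (f (v i) / f (v a)) • v a) (t - (f t / f (v a)) • v a) with
      ⟨c, hc, hct⟩ | ⟨g, hg, hgt⟩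
    · left
      -- The coefficient of `v a` needed to undo the projection; it is nonnegative because `f t > 0`
      -- while `f (v i) ≤ 0` on `s`.
      set r : ℝ := f t / f (v a) - ∑ i ∈ s, c i * (f (v i) / f (v a)) with hr
      refine ⟨Function.update c a r, fun i hi => ?_, ?_⟩
      · rcases eq_or_ne i a with rfl | h'
        · have h1 : 0 ≤ f t / f (v i) := by positivity
          have h2 : ∑ j ∈ s, c j * (f (v j) / f (v i)) ≤ 0 :=
            Finset.sum_nonpos fun j hj => mul_nonpos_of_nonneg_of_nonpos (hc j hj)
              (div_nonpos_of_nonpos_of_nonneg (hf j hj) h.le)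
          rw [Function.update_self]
          linarith
        · simpa [h'] using hc i (Finset.mem_of_mem_insert_of_ne hi h')
      · rw [Finset.sum_insert ha, Function.update_self]
        have h1 : ∑ i ∈ s, Function.update c a r i • v i = ∑ i ∈ s, c i • v i :=
          Finset.sum_congr rfl fun i hi => by
            rw [Function.update_of_ne (ne_of_mem_of_not_mem hi ha)]
        simp only [smul_sub, smul_smul, Finset.sum_sub_distrib, ← Finset.sum_smul] at hct
        rw [h1, hr, sub_smul, sub_eq_sub_iff_add_eq_add.1 hct |> fun e => eq_sub_of_add_eq e]
        abel
    · right
      -- This is `g` composed with the projection, so it vanishes at `v a`.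
      refine ⟨g - (g (v a) / f (v a)) • f, fun i hi => ?_, ?_⟩
      · rcases eq_or_ne i a with rfl | h'
        · simp [h.ne']
        · have := hg i (Finset.mem_of_mem_insert_of_ne hi h')
          simp only [map_sub, map_smul, smul_eq_mul, LinearMap.sub_apply,
            LinearMap.smul_apply] at this ⊢
          rwa [div_mul_comm] at this
      · simp only [map_sub, map_smul, smul_eq_mul, LinearMap.sub_apply,
            LinearMap.smul_apply] at hgt ⊢
        rwa [div_mul_comm] at hgt

/-- Every linear functional on `ℝⁿ` is the dot product with a vector. -/
theorem exists_dotProduct_eq {n : ℕ} (f : Module.Dual ℝ (Fin n → ℝ)) :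
    ∃ y : Fin n → ℝ, ∀ x, f x = y ⬝ᵥ x := by
  refine ⟨fun i => f (Pi.single i 1), fun x => ?_⟩
  conv_lhs => rw [← Finset.univ_sum_single x, map_sum]
  refine Finset.sum_congr rfl fun i _ => ?_
  rw [mul_comm, ← smul_eq_mul, ← map_smul]
  congr 1
  ext j
  by_cases h : j = i <;> simp [h]

/-- The convex hull of a finite family of points, in terms of weights. -/
theorem mem_convexHull_image_finset {V ι : Type*} [AddCommGroup V] [Module ℝ V]
    (s : Finset ι) (z : ι → V) (x : V) :
    x ∈ convexHull ℝ (z '' (s : Set ι)) ↔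
      ∃ w : ι → ℝ, (∀ i ∈ s, 0 ≤ w i) ∧ ∑ i ∈ s, w i = 1 ∧ ∑ i ∈ s, w i • z i = x := by
  classical
  constructor
  · intro hx
    refine convexHull_min (t := {x | ∃ w : ι → ℝ, (∀ i ∈ s, 0 ≤ w i) ∧ ∑ i ∈ s, w i = 1 ∧
      ∑ i ∈ s, w i • z i = x}) ?_ ?_ hx
    · rintro _ ⟨i, hi, rfl⟩
      have hi' : i ∈ s := hi
      refine ⟨Pi.single i 1, fun j _ => ?_, ?_, ?_⟩
      · by_cases h : j = i <;> simp [h]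
      · simp [Pi.single_apply, hi']
      · simp [Pi.single_apply, ite_smul, hi']
    · rintro _ ⟨w, hw, hw1, rfl⟩ _ ⟨w', hw', hw1', rfl⟩ α β hα hβ hαβ
      refine ⟨fun i => α * w i + β * w' i, fun i hi => ?_, ?_, ?_⟩
      · have := hw i hi
        have := hw' i hi
        positivity
      · rw [Finset.sum_add_distrib, ← Finset.mul_sum, ← Finset.mul_sum, hw1, hw1']
        linarith
      · simp only [add_smul, mul_smul, Finset.sum_add_distrib, ← Finset.smul_sum]
  · rintro ⟨w, hw, hw1, rfl⟩
    exact (convex_convexHull ℝ _).sum_mem hw hw1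
      fun i hi => subset_convexHull ℝ _ (Set.mem_image_of_mem z hi)

/-- Compactness makes the linear program in the weights attain its maximum. -/
theorem stdSimplex_fiber_isCompact {n : ℕ} {ι : Type*} [Fintype ι] (z : ι → Fin n → ℝ)
    (a : Fin n → ℝ) : IsCompact {w | w ∈ stdSimplex ℝ ι ∧ ∑ i, w i • z i = a} :=
  (isCompact_stdSimplex ℝ ι).inter_right
    (isClosed_eq (by fun_prop) continuous_const)

/-- Strong duality with complementary slackness: a convex combination of the points `z i` is also
a convex combination of those that maximize `val i - p · z i`, for a suitable price `p`. -/
theorem exists_supporting_price {n : ℕ} {ι : Type*} [Fintype ι] (z : ι → Fin n → ℝ)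
    (val : ι → ℝ) (a : Fin n → ℝ) (ha : a ∈ convexHull ℝ (Set.range z)) :
    ∃ (p : Fin n → ℝ) (s : ℝ), ∃ w ∈ stdSimplex ℝ ι, ∑ i, w i • z i = a ∧
      (∀ i, val i - p ⬝ᵥ z i ≤ s) ∧ ∀ i, w i ≠ 0 → val i - p ⬝ᵥ z i = s := by
  classical
  have hne : {w | w ∈ stdSimplex ℝ ι ∧ ∑ i, w i • z i = a}.Nonempty := by
    rw [← Set.image_univ, ← Finset.coe_univ, mem_convexHull_image_finset] at ha
    obtain ⟨w, h0, h1, h2⟩ := ha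
    exact ⟨w, ⟨fun i => h0 i (Finset.mem_univ i), h1⟩, h2⟩
  obtain ⟨w, ⟨⟨hw0, hw1⟩, hwa⟩, hmax⟩ := (stdSimplex_fiber_isCompact z a).exists_isMaxOn hne
    (f := fun w => ∑ i, w i * val i) (by fun_prop)
  let g : ι → ℝ × (Fin n → ℝ) × ℝ := fun i => (1, z i, val i)
  -- Adding the generators `-(w i • g i)` encodes complementary slackness: a combination may have
  -- negative coefficients only where `w i` is nonzero, and dually `f` must vanish on those `g i`.
  -- The target `(0, 0, 1)` is a feasible direction of strict improvement.
  rcases farkas_finset (Finset.univ : Finset (ι ⊕ ι)) (Sum.elim g fun i => -(w i • g i))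
    ((0, 0, 1) : ℝ × (Fin n → ℝ) × ℝ) with ⟨c, hc, hct⟩ | ⟨f, hf, hft⟩
  · exfalso
    rw [Fintype.sum_sum_type] at hct
    set e : ι → ℝ := fun i => c (Sum.inl i) - c (Sum.inr i) * w i with he
    have hsum : ∑ i, e i • g i = (0, 0, 1) := by
      rw [← hct, ← Finset.sum_add_distrib]
      refine Finset.sum_congr rfl fun i _ => ?_
      simp only [he, Sum.elim_inl, Sum.elim_inr, sub_smul, mul_smul, smul_neg]
      abel
    have e1 : ∑ i, e i = 0 := by
      simpa [g, Prod.fst_sum] using congrArg Prod.fst hsum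
    have e2 : ∑ i, e i • z i = 0 := by
      simpa [g, Prod.fst_sum, Prod.snd_sum] using congrArg (fun x => x.2.1) hsum
    have e3 : ∑ i, e i * val i = 1 := by
      simpa [g, Prod.fst_sum, Prod.snd_sum] using congrArg (fun x => x.2.2) hsum
    have hd : ∀ i, 0 ≤ c (Sum.inr i) := fun i => hc _ (Finset.mem_univ _)
    -- Large enough that the step `C⁻¹ * e i` keeps every weight nonnegative; moving along `e` then
    -- contradicts the maximality of `w`.
    set C : ℝ := 1 + ∑ i, c (Sum.inr i) with hC
    have hCpos : 0 < C := by
      have := Finset.sum_nonneg fun i (_ : i ∈ (Finset.univ : Finset ι)) => hd i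
      linarith
    have hmem : (fun i => w i + C⁻¹ * e i) ∈
        {w | w ∈ stdSimplex ℝ ι ∧ ∑ i, w i • z i = a} := by
      refine ⟨⟨fun i => ?_, ?_⟩, ?_⟩
      · have h1 : c (Sum.inr i) ≤ C := by
          have := Finset.single_le_sum (f := fun i => c (Sum.inr i)) (fun i _ => hd i)
            (Finset.mem_univ i)
          linarith
        have h2 : C⁻¹ * c (Sum.inr i) ≤ 1 := by
          rw [inv_mul_le_iff₀ hCpos]
          linarith
        have h3 : 0 ≤ C⁻¹ * c (Sum.inl i) :=
          mul_nonneg (inv_nonneg.2 hCpos.le) (hc _ (Finset.mem_univ _))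
        have h4 := mul_le_mul_of_nonneg_right h2 (hw0 i)
        simp only [he]
        linarith
      · rw [Finset.sum_add_distrib, ← Finset.mul_sum, e1, hw1]
        simp
      · simp only [add_smul, mul_smul, Finset.sum_add_distrib, ← Finset.smul_sum]
        rw [e2, hwa]
        simp
    have hle := hmax hmem
    simp only [Set.mem_ofPred_eq, add_mul, mul_assoc, Finset.sum_add_distrib,
      ← Finset.mul_sum, e3] at hle
    have := inv_pos.2 hCpos
    linarith
  · set r := f (0, 0, 1) with hr
    obtain ⟨y, hy⟩ := exists_dotProduct_eq
      (f ∘ₗ LinearMap.inr ℝ ℝ ((Fin n → ℝ) × ℝ) ∘ₗ LinearMap.inl ℝ (Fin n → ℝ) ℝ)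
    have hfg : ∀ i, f (g i) = f (1, 0, 0) + y ⬝ᵥ z i + val i * r := by
      intro i
      have : g i = (1, 0, 0) + (0, z i, 0) + val i • (0, 0, 1) := by simp [g]
      rw [this, map_add, map_add, map_smul, ← hy]
      rfl
    have hp : ∀ i, val i - (-r⁻¹ • y) ⬝ᵥ z i - (-(r⁻¹ * f (1, 0, 0))) = r⁻¹ * f (g i) := by
      intro i
      rw [hfg, smul_dotProduct, smul_eq_mul]
      field_simp
      ring
    refine ⟨-r⁻¹ • y, -(r⁻¹ * f (1, 0, 0)), w, ⟨hw0, hw1⟩, hwa, fun i => ?_, fun i hi => ?_⟩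
    · have h1 := hf (Sum.inl i) (Finset.mem_univ _)
      rw [← sub_nonpos, hp]
      exact mul_nonpos_of_nonneg_of_nonpos (inv_nonneg.2 hft.le) h1
    · have h1 : f (g i) ≤ 0 := hf (Sum.inl i) (Finset.mem_univ _)
      have h2 := hf (Sum.inr i) (Finset.mem_univ _)
      simp only [Sum.elim_inr, map_neg, map_smul, smul_eq_mul, Left.neg_nonpos_iff] at h2
      have h3 : f (g i) = 0 :=
        le_antisymm h1 (nonneg_of_mul_nonneg_right h2 (lt_of_le_of_ne (hw0 i) hi.symm))
      rw [← sub_eq_zero, hp, h3, mul_zero]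

/-! ### Cells, faces and edges -/

theorem Utility.demand_eq_cell {n : ℕ} (u : Utility n) (p : Fin n → ℝ) :
    u.demand p = u.cell (-p) := by
  ext a
  simp only [Utility.demand, Utility.cell, dotProduct_neg, dotProduct_comm p, sub_eq_add_neg]

theorem Utility.cell_subset {n : ℕ} (u : Utility n) (x : Fin n → ℝ) :
    u.cell x ⊆ (u.bundles : Set (Fin n → ℤ)) := fun _ ha => ha.1

theorem Utility.cell_finite {n : ℕ} (u : Utility n) (x : Fin n → ℝ) : (u.cell x).Finite :=
  u.bundles.finite_toSet.subset (u.cell_subset x)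

theorem Utility.mem_cell_of_mem_cell {n : ℕ} {u : Utility n} {x : Fin n → ℝ} {a b : Fin n → ℤ}
    (ha : a ∈ u.cell x) (hb : b ∈ u.bundles)
    (h : u.value a + toReal a ⬝ᵥ x ≤ u.value b + toReal b ⬝ᵥ x) : b ∈ u.cell x :=
  ⟨hb, fun c hc => (ha.2 c hc).trans h⟩

/-- The face of a cell on which a linear functional is maximal is again a cell. -/
theorem Utility.exists_cell_eq_face {n : ℕ} (u : Utility n) (x y : Fin n → ℝ) {m : Fin n → ℤ}
    (hm : m ∈ u.cell x) (hmax : ∀ b ∈ u.cell x, toReal b ⬝ᵥ y ≤ toReal m ⬝ᵥ y) :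
    ∃ x', u.cell x' = {a ∈ u.cell x | toReal a ⬝ᵥ y = toReal m ⬝ᵥ y} := by
  -- Tilting `x` by a small multiple of `y` preserves the finitely many strict inequalities, so only
  -- ties on the old cell are broken, and `y` breaks them.
  have key : ∀ᶠ ε : ℝ in nhdsWithin 0 (Set.Ioi 0), ∀ b ∈ u.bundles,
      u.value b + toReal b ⬝ᵥ x < u.value m + toReal m ⬝ᵥ x →
      u.value b + toReal b ⬝ᵥ x + ε * (toReal b ⬝ᵥ y) <
        u.value m + toReal m ⬝ᵥ x + ε * (toReal m ⬝ᵥ y) := by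
    rw [Filter.eventually_all_finset]
    intro b _
    by_cases h : u.value b + toReal b ⬝ᵥ x < u.value m + toReal m ⬝ᵥ x
    · simp only [h, forall_true_left]
      refine Filter.Eventually.filter_mono nhdsWithin_le_nhds ?_
      refine ContinuousAt.eventually_lt (by fun_prop) (by fun_prop) ?_
      simpa using h
    · simp [h]
  obtain ⟨ε, hε, hε0⟩ := (key.and self_mem_nhdsWithin).exists
  replace hε0 : 0 < ε := hε0
  have hval : ∀ b, u.value b + toReal b ⬝ᵥ (x + ε • y) =
      u.value b + toReal b ⬝ᵥ x + ε * (toReal b ⬝ᵥ y) := fun b => by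
    rw [dotProduct_add, dotProduct_smul, smul_eq_mul, add_assoc]
  have hmm : ∀ b ∈ u.bundles, u.value b + toReal b ⬝ᵥ (x + ε • y) ≤
      u.value m + toReal m ⬝ᵥ (x + ε • y) := by
    intro b hb
    rw [hval, hval]
    rcases (hm.2 b hb).lt_or_eq with h | h
    · exact (hε b hb h).le
    · have := mul_le_mul_of_nonneg_left (hmax b (mem_cell_of_mem_cell hm hb h.ge)) hε0.le
      linarith
  refine ⟨x + ε • y, Set.ext fun a => ⟨fun ha => ?_, fun ha => ?_⟩⟩
  · have h1 := ha.2 m hm.1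
    rw [hval, hval] at h1
    have hax : a ∈ u.cell x := by
      refine mem_cell_of_mem_cell hm ha.1 (le_of_not_gt fun h => ?_)
      exact absurd (hε a ha.1 h) (not_lt.2 h1)
    refine ⟨hax, le_antisymm (hmax a hax) ?_⟩
    have h2 := hm.2 a hax.1
    exact le_of_mul_le_mul_left (by linarith) hε0
  · have h1 := ha.1.2 m hm.1
    refine ⟨ha.1.1, fun b hb => (hmm b hb).trans ?_⟩
    rw [hval, hval, ha.2]
    linarith

theorem sub_mem_direction {n : ℕ} {σ : Set (Fin n → ℤ)} {a b : Fin n → ℤ} (ha : a ∈ σ)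
    (hb : b ∈ σ) : toReal a - toReal b ∈ direction σ :=
  vsub_mem_vectorSpan ℝ (Set.mem_image_of_mem _ ha) (Set.mem_image_of_mem _ hb)

theorem direction_mono {n : ℕ} {σ τ : Set (Fin n → ℤ)} (h : σ ⊆ τ) :
    direction σ ≤ direction τ :=
  vectorSpan_mono ℝ (Set.image_mono h)

/-- A functional is constant on a set of lattice points iff it vanishes on its direction space. -/
theorem dotProduct_eq_zero_of_forall_eq {n : ℕ} {σ : Set (Fin n → ℤ)} {y : Fin n → ℝ}
    (h : ∀ a ∈ σ, ∀ b ∈ σ, toReal a ⬝ᵥ y = toReal b ⬝ᵥ y) {v : Fin n → ℝ}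
    (hv : v ∈ direction σ) : v ⬝ᵥ y = 0 := by
  rw [direction, vectorSpan_def] at hv
  induction hv using Submodule.span_induction with
  | mem x hx =>
    obtain ⟨_, ⟨a, ha, rfl⟩, _, ⟨b, hb, rfl⟩, rfl⟩ := hx
    simp only [vsub_eq_sub, sub_dotProduct]
    linarith [h a ha b hb]
  | zero => simp
  | add x z _ _ hx hz => rw [add_dotProduct, hx, hz, add_zero]
  | smul c x _ hx => rw [smul_dotProduct, hx, smul_zero]

theorem forall_eq_of_dotProduct_eq_zero {n : ℕ} {σ : Set (Fin n → ℤ)} {y : Fin n → ℝ}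
    (h : ∀ v ∈ direction σ, v ⬝ᵥ y = 0) {a b : Fin n → ℤ} (ha : a ∈ σ) (hb : b ∈ σ) :
    toReal a ⬝ᵥ y = toReal b ⬝ᵥ y := by
  have := h _ (sub_mem_direction ha hb)
  rw [sub_dotProduct] at this
  linarith

/-- Parametric simplex step: if `y` is not constant on a cell of dimension at least two, then it is
not constant on some proper face of it. -/
theorem Utility.exists_ssubset_cell {n : ℕ} (u : Utility n) (x y : Fin n → ℝ)
    (hdim : 2 ≤ Module.finrank ℝ (direction (u.cell x))) {a₀ b₀ : Fin n → ℤ}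
    (ha₀ : a₀ ∈ u.cell x) (hb₀ : b₀ ∈ u.cell x) (hlt : toReal b₀ ⬝ᵥ y < toReal a₀ ⬝ᵥ y) :
    ∃ x', u.cell x' ⊂ u.cell x ∧ ∃ a ∈ u.cell x', ∃ b ∈ u.cell x',
      toReal a ⬝ᵥ y ≠ toReal b ⬝ᵥ y := by
  -- In dimension at least two, the restriction of `y` to the direction space has a nonzero kernel.
  obtain ⟨w, hw, hw0, hwy⟩ : ∃ w ∈ direction (u.cell x), w ≠ 0 ∧ w ⬝ᵥ y = 0 := by
    let f : direction (u.cell x) →ₗ[ℝ] ℝ :=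
      ((dotProductBilin ℝ ℝ).flip y) ∘ₗ (direction (u.cell x)).subtype
    have hker : LinearMap.ker f ≠ ⊥ := by
      apply LinearMap.ker_ne_bot_of_finrank_lt
      simpa [Nat.lt_iff_add_one_le] using hdim
    obtain ⟨w, hw, hw0⟩ := (Submodule.ne_bot_iff _).1 hker
    exact ⟨w, w.2, by simpa using hw0, hw⟩
  have hfin := u.cell_finite x
  obtain ⟨a₁, ha₁, hmax₁⟩ := Set.exists_max_image _ (fun a => toReal a ⬝ᵥ y) hfin ⟨a₀, ha₀⟩
  obtain ⟨a, ⟨ha, hay⟩, hamax⟩ := Set.exists_max_image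
    {a ∈ u.cell x | toReal a ⬝ᵥ y = toReal a₁ ⬝ᵥ y} (fun a => toReal a ⬝ᵥ w)
    (hfin.subset (Set.sep_subset _ _)) ⟨a₁, ha₁, rfl⟩
  have hmax : ∀ b ∈ u.cell x, toReal b ⬝ᵥ y ≤ toReal a ⬝ᵥ y := fun b hb =>
    (hmax₁ b hb).trans hay.ge
  -- The largest ratio is the smallest `t` for which `a` still maximizes `w + t • y`; there `b` ties
  -- with `a` although its `y`-value is smaller.
  obtain ⟨b, ⟨hb, hby⟩, hbmax⟩ := Set.exists_max_image
    {b ∈ u.cell x | toReal b ⬝ᵥ y < toReal a ⬝ᵥ y}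
    (fun b => (toReal b ⬝ᵥ w - toReal a ⬝ᵥ w) / (toReal a ⬝ᵥ y - toReal b ⬝ᵥ y))
    (hfin.subset (Set.sep_subset _ _)) ⟨b₀, hb₀, hlt.trans_le (hmax a₀ ha₀)⟩
  set t : ℝ := (toReal b ⬝ᵥ w - toReal a ⬝ᵥ w) / (toReal a ⬝ᵥ y - toReal b ⬝ᵥ y) with ht
  have htop : ∀ c ∈ u.cell x, toReal c ⬝ᵥ (w + t • y) ≤ toReal a ⬝ᵥ (w + t • y) := by
    intro c hc
    simp only [dotProduct_add, dotProduct_smul, smul_eq_mul]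
    rcases (hmax c hc).lt_or_eq with h | h
    · have h1 := hbmax c ⟨hc, h⟩
      rw [div_le_iff₀ (by linarith)] at h1
      linarith
    · have h1 := hamax c ⟨hc, h.trans hay⟩
      rw [h]
      linarith
  have hbt : toReal b ⬝ᵥ (w + t • y) = toReal a ⬝ᵥ (w + t • y) := by
    simp only [dotProduct_add, dotProduct_smul, smul_eq_mul]
    have h1 : t * (toReal a ⬝ᵥ y - toReal b ⬝ᵥ y) = toReal b ⬝ᵥ w - toReal a ⬝ᵥ w :=
      div_mul_cancel₀ _ (by linarith)
    linarith
  obtain ⟨x', hx'⟩ := u.exists_cell_eq_face x (w + t • y) ha htop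
  refine ⟨x', ?_, a, ?_, b, ?_, hby.ne'⟩
  · rw [hx', Set.ssubset_iff_subset_ne]
    -- Were the face the whole cell, `w + t • y` would be orthogonal to `w`, giving `w ⬝ᵥ w = 0`.
    refine ⟨Set.sep_subset _ _, fun heq => hw0 ?_⟩
    have hall := Set.sep_eq_self_iff_mem_true.1 heq
    have := dotProduct_eq_zero_of_forall_eq
      (fun c hc d hd => (hall c hc).trans (hall d hd).symm) hw
    rw [dotProduct_add, dotProduct_smul, hwy, smul_zero, add_zero] at this
    exact dotProduct_self_eq_zero.1 this
  · rw [hx']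
    exact ⟨ha, rfl⟩
  · rw [hx']
    exact ⟨hb, hbt⟩

/-- A functional that is constant on all edges of a cell is constant on the cell. -/
theorem Utility.dotProduct_eq_of_edges {n : ℕ} (u : Utility n) (y : Fin n → ℝ) :
    ∀ (k : ℕ) (x : Fin n → ℝ), (u.cell x).ncard = k →
      (∀ τ ∈ u.edges, τ ⊆ u.cell x → ∀ v ∈ direction τ, v ⬝ᵥ y = 0) →
      ∀ a ∈ u.cell x, ∀ b ∈ u.cell x, toReal a ⬝ᵥ y = toReal b ⬝ᵥ y := by
  intro k
  induction k using Nat.strong_induction_on with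
  | _ k ih =>
    intro x hk hedge
    by_contra! hcon
    obtain ⟨a, ha, b, hb, hne⟩ := hcon
    rcases Nat.lt_or_ge (Module.finrank ℝ (direction (u.cell x))) 2 with h2 | h2
    · interval_cases hfr : Module.finrank ℝ (direction (u.cell x))
      · refine hne (forall_eq_of_dotProduct_eq_zero (fun v hv => ?_) ha hb)
        rw [Submodule.finrank_eq_zero.1 hfr, Submodule.mem_bot] at hv
        rw [hv, zero_dotProduct]
      · exact hne (forall_eq_of_dotProduct_eq_zero
          (hedge _ ⟨⟨x, rfl⟩, hfr⟩ subset_rfl) ha hb)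
    · obtain ⟨x', hss, c, hc, d, hd, hcd⟩ : ∃ x', u.cell x' ⊂ u.cell x ∧
          ∃ a ∈ u.cell x', ∃ b ∈ u.cell x', toReal a ⬝ᵥ y ≠ toReal b ⬝ᵥ y := by
        rcases lt_or_gt_of_ne hne with h | h
        · exact u.exists_ssubset_cell x y h2 hb ha h
        · exact u.exists_ssubset_cell x y h2 ha hb h
      exact hcd (ih _ (hk ▸ Set.ncard_lt_ncard hss (u.cell_finite x)) x' rfl
        (fun τ hτ hsub => hedge τ hτ (hsub.trans hss.subset)) c hc d hd)

/-- The direction space of a cell is spanned by the vectors of the demand type that it contains. -/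
theorem Utility.direction_cell_eq_span {n : ℕ} {u : Utility n} {D : Set (Fin n → ℤ)}
    (hu : u.IsOfDemandType D) (x : Fin n → ℝ) :
    direction (u.cell x) =
      Submodule.span ℝ (toReal '' {v ∈ D | toReal v ∈ direction (u.cell x)}) := by
  refine le_antisymm (fun v hv => ?_) (Submodule.span_le.2 ?_)
  · by_contra hnot
    -- A functional that kills the span kills every edge of the cell, hence its whole direction
    -- space, including `v`.
    obtain ⟨f, hfv, hf⟩ := Submodule.exists_le_ker_of_notMem hnot
    obtain ⟨y, hy⟩ := exists_dotProduct_eq f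
    refine hfv ?_
    rw [hy, dotProduct_comm]
    refine dotProduct_eq_zero_of_forall_eq
      (u.dotProduct_eq_of_edges y _ x rfl fun τ hτ hsub z hz => ?_) hv
    obtain ⟨d, hd, hdir⟩ := hu τ hτ
    have hdx : toReal d ∈ direction (u.cell x) :=
      direction_mono hsub (hdir ▸ Submodule.mem_span_singleton_self _)
    have hzk : z ∈ LinearMap.ker f := by
      refine hf ?_
      rw [hdir] at hz
      refine Submodule.span_mono (Set.singleton_subset_iff.2 ?_) hz
      exact ⟨d, ⟨hd, hdx⟩, rfl⟩
    rw [dotProduct_comm, ← hy]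
    exact hzk
  · rintro _ ⟨d, hd, rfl⟩
    exact hd.2

/-! ### Concavity and relative interiors -/

/-- The lattice points of the convex hull of a demand set of a concave utility are demanded. -/
theorem Utility.IsConcave.mem_cell_of_mem_convexHull {n : ℕ} {u : Utility n} (hu : u.IsConcave)
    {x : Fin n → ℝ} {a : Fin n → ℤ} (ha : toReal a ∈ convexHull ℝ (toReal '' u.cell x)) :
    a ∈ u.cell x := by
  have hab : a ∈ u.bundles :=
    hu.1 a (convexHull_mono (Set.image_mono (u.cell_subset x)) ha)
  obtain ⟨z, hz⟩ := hu.2 a hab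
  obtain ⟨s, hs⟩ := (u.cell_finite x).exists_finset_coe
  rw [← hs, mem_convexHull_image_finset] at ha
  obtain ⟨w, hw0, hw1, hwa⟩ := ha
  have hmem : ∀ b ∈ s, b ∈ u.cell x := fun b hb => hs ▸ Finset.mem_coe.2 hb
  have hdot : ∀ y, toReal a ⬝ᵥ y = ∑ b ∈ s, w b * (toReal b ⬝ᵥ y) := fun y => by
    rw [← hwa, sum_dotProduct]
    simp only [smul_dotProduct, smul_eq_mul]
  -- The supporting vector `z` at `a` puts `u.value a` above the weighted average of the values, so
  -- at `x` the bundle `a` does at least as well as the average of maximizers.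
  have hval : ∑ b ∈ s, w b * u.value b ≤ u.value a := by
    have : ∑ b ∈ s, w b * (u.value b + toReal b ⬝ᵥ z) ≤
        ∑ b ∈ s, w b * (u.value a + toReal a ⬝ᵥ z) :=
      Finset.sum_le_sum fun b hb =>
        mul_le_mul_of_nonneg_left (hz.2 b (hmem b hb).1) (hw0 b hb)
    rw [← Finset.sum_mul, hw1] at this
    simp only [mul_add, Finset.sum_add_distrib, ← hdot] at this
    linarith
  refine ⟨hab, fun c hc => ?_⟩
  have : ∑ b ∈ s, w b * (u.value c + toReal c ⬝ᵥ x) ≤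
      ∑ b ∈ s, w b * (u.value b + toReal b ⬝ᵥ x) :=
    Finset.sum_le_sum fun b hb => mul_le_mul_of_nonneg_left ((hmem b hb).2 c hc) (hw0 b hb)
  rw [← Finset.sum_mul, hw1] at this
  simp only [mul_add, Finset.sum_add_distrib, ← hdot] at this
  linarith

/-- A point in the convex hull of a cell lies in the relative interior of the convex hull of some
cell contained in it. -/
theorem Utility.exists_cell_relint {n : ℕ} (u : Utility n) (x : Fin n → ℝ) (q : Fin n → ℝ)
    (hq : q ∈ convexHull ℝ (toReal '' u.cell x)) :
    ∃ x', u.cell x' ⊆ u.cell x ∧ (u.cell x').Nonempty ∧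
      ∀ v ∈ direction (u.cell x'), ∃ ε > 0, q + (ε : ℝ) • v ∈ convexHull ℝ (toReal '' u.cell x') := by
  classical
  -- A cell with the fewest points among those whose hull contains `q` is the one wanted.
  have hex : ∃ k : ℕ, ∃ x', u.cell x' ⊆ u.cell x ∧
      q ∈ convexHull ℝ (toReal '' u.cell x') ∧ (u.cell x').ncard = k :=
    ⟨_, x, subset_rfl, hq, rfl⟩
  obtain ⟨x', hsub, hqx', hcard⟩ := Nat.find_spec hex
  have hne : (u.cell x').Nonempty :=
    Set.image_nonempty.1 (convexHull_nonempty_iff.1 ⟨q, hqx'⟩)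
  refine ⟨x', hsub, hne, fun v hv => ?_⟩
  obtain ⟨s, hs⟩ := (u.cell_finite x').exists_finset_coe
  simp only [← hs, mem_convexHull_image_finset]
  have hqs := hqx'
  rw [← hs, mem_convexHull_image_finset] at hqs
  obtain ⟨w, hw0, hw1, hwq⟩ := hqs
  -- Either `v` lies in the cone of the vectors `b - q`, and a short step stays in the hull, or a
  -- functional separates it and cuts out a face whose hull still contains `q`. Minimality makes
  -- that face the whole cell, so the functional vanishes on `v`.
  rcases farkas_finset s (fun b => toReal b - q) v with ⟨c, hc0, hcv⟩ | ⟨f, hf, hfv⟩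
  · set C := ∑ b ∈ s, c b with hC
    have hC0 : 0 ≤ C := Finset.sum_nonneg hc0
    have hC1 : (1 + C) ≠ 0 := by positivity
    refine ⟨(1 + C)⁻¹, by positivity, fun b => (1 + C)⁻¹ * (w b + c b), fun b hb => ?_, ?_, ?_⟩
    · have := hw0 b hb
      have := hc0 b hb
      positivity
    · rw [← Finset.mul_sum, Finset.sum_add_distrib, hw1, ← hC, inv_mul_cancel₀ hC1]
    · simp only [smul_sub, Finset.sum_sub_distrib, ← Finset.sum_smul] at hcv
      rw [← hC] at hcv
      simp only [mul_smul, ← Finset.smul_sum, add_smul, Finset.sum_add_distrib]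
      rw [hwq, sub_eq_iff_eq_add.1 hcv]
      have : q + (v + C • q) = (1 + C) • q + v := by
        rw [add_smul, one_smul]
        abel
      rw [this, smul_add, smul_smul, inv_mul_cancel₀ hC1, one_smul]
  · exfalso
    obtain ⟨y, hy⟩ := exists_dotProduct_eq f
    have hle : ∀ b ∈ s, toReal b ⬝ᵥ y ≤ q ⬝ᵥ y := fun b hb => by
      have := hf b hb
      rwa [hy, dotProduct_comm, sub_dotProduct, sub_nonpos] at this
    have hsum : ∑ b ∈ s, w b * (q ⬝ᵥ y - toReal b ⬝ᵥ y) = 0 := by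
      have : q ⬝ᵥ y = ∑ b ∈ s, w b * (toReal b ⬝ᵥ y) := by
        conv_lhs => rw [← hwq, sum_dotProduct]
        simp only [smul_dotProduct, smul_eq_mul]
      simp only [mul_sub, Finset.sum_sub_distrib, ← Finset.sum_mul, hw1]
      rw [← this]
      ring
    have hzero := (Finset.sum_eq_zero_iff_of_nonneg fun b hb =>
      mul_nonneg (hw0 b hb) (sub_nonneg.2 (hle b hb))).1 hsum
    have htight : ∀ b ∈ s, w b ≠ 0 → toReal b ⬝ᵥ y = q ⬝ᵥ y := fun b hb hwb => by
      have := (mul_eq_zero.1 (hzero b hb)).resolve_left hwb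
      linarith
    obtain ⟨m, hm, hwm⟩ : ∃ m ∈ s, w m ≠ 0 := by
      by_contra! h
      rw [Finset.sum_eq_zero h] at hw1
      exact zero_ne_one hw1
    have hmem : ∀ b, b ∈ s ↔ b ∈ u.cell x' := fun b => by rw [← hs, Finset.mem_coe]
    have hmy := htight m hm hwm
    obtain ⟨x'', hx''⟩ := u.exists_cell_eq_face x' y ((hmem m).1 hm)
      fun b hb => hmy ▸ hle b ((hmem b).2 hb)
    have hsub' : u.cell x'' ⊆ u.cell x' := hx'' ▸ Set.sep_subset _ _
    have hq'' : q ∈ convexHull ℝ (toReal '' u.cell x'') := by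
      rw [← hwq, ← Finset.sum_filter_ne_zero]
      have hcongr : ∑ b ∈ s with w b • toReal b ≠ 0, w b • toReal b =
          ∑ b ∈ s with w b ≠ 0, w b • toReal b := by
        rw [Finset.sum_filter_ne_zero, Finset.sum_filter_of_ne]
        intro b _ h h0
        exact h (by rw [h0, zero_smul])
      rw [hcongr]
      refine (convex_convexHull ℝ _).sum_mem (fun b hb => hw0 b (Finset.mem_filter.1 hb).1)
        (by rw [Finset.sum_filter_ne_zero, hw1]) fun b hb => subset_convexHull ℝ _ ?_
      obtain ⟨hb, hwb⟩ := Finset.mem_filter.1 hb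
      refine Set.mem_image_of_mem _ ?_
      rw [hx'']
      exact ⟨(hmem b).1 hb, (htight b hb hwb).trans hmy.symm⟩
    have heq : u.cell x'' = u.cell x' := by
      refine Set.eq_of_subset_of_ncard_le hsub' ?_ (u.cell_finite x')
      rw [hcard]
      exact Nat.find_min' hex ⟨x'', hsub'.trans hsub, hq'', rfl⟩
    have hall := Set.sep_eq_self_iff_mem_true.1 (hx''.symm.trans heq)
    have := dotProduct_eq_zero_of_forall_eq
      (fun c hc d hd => (hall c hc).trans (hall d hd).symm) hv
    rw [hy, dotProduct_comm, this] at hfv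
    exact lt_irrefl _ hfv

/-! ### Integer vectors inside real space -/

theorem toReal_sub {n : ℕ} (a b : Fin n → ℤ) : toReal (a - b) = toReal a - toReal b := by
  ext i
  simp [toReal]

theorem toReal_injective {n : ℕ} : Function.Injective (toReal : (Fin n → ℤ) → Fin n → ℝ) :=
  fun _ _ h => funext fun i => Int.cast_injective (congrFun h i)

/-- The embedding of `ℤⁿ` in `ℝⁿ` as a homomorphism of `ℤ`-modules. -/
noncomputable def toRealHom (n : ℕ) : (Fin n → ℤ) →ₗ[ℤ] (Fin n → ℝ) where
  toFun := toReal
  map_add' _ _ := by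
    ext i
    simp [toReal]
  map_smul' c a := by
    ext i
    simp [toReal]

theorem toReal_add {n : ℕ} (a b : Fin n → ℤ) : toReal (a + b) = toReal a + toReal b :=
  (toRealHom n).map_add a b

theorem toReal_zsmul {n : ℕ} (c : ℤ) (a : Fin n → ℤ) : toReal (c • a) = (c : ℝ) • toReal a := by
  ext i
  simp [toReal]

theorem toReal_sum {n : ℕ} {ι : Type*} (s : Finset ι) (f : ι → Fin n → ℤ) :
    toReal (∑ i ∈ s, f i) = ∑ i ∈ s, toReal (f i) :=
  map_sum (toRealHom n) f s

/-- In a unimodular set, every subset generates all lattice points of its real span. -/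
theorem IsUnimodular.mem_span {n : ℕ} {D T : Set (Fin n → ℤ)} (hD : IsUnimodular D) (hT : T ⊆ D)
    {w : Fin n → ℤ} (hw : toReal w ∈ Submodule.span ℝ (toReal '' T)) :
    w ∈ Submodule.span ℤ T := by
  obtain ⟨B, hBT, hspan, hind⟩ := exists_linearIndependent ℝ (toReal '' T)
  have hB : toReal '' (toReal ⁻¹' B ∩ T) = B := by
    rw [Set.image_preimage_inter, Set.inter_eq_left.2 hBT]
  refine Submodule.span_mono Set.inter_subset_right
    (hD _ (Set.inter_subset_right.trans hT) ?_ w (by rwa [hB, hspan]))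
  have : Function.Injective fun v : ↥(toReal ⁻¹' B ∩ T) => (⟨toReal v.1, v.2.1⟩ : B) :=
    fun a b h => Subtype.ext (toReal_injective (congrArg Subtype.val h))
  exact hind.comp _ this

/-! ### Unimodularity implies equilibrium -/

/-- Prices at which a point of the convex hull of the total supply is a sum of points of the
convex hulls of the demand sets. -/
theorem exists_price_convexHull_demand {n J : ℕ} (u : Fin J → Utility n) {a : Fin n → ℝ}
    (ha : a ∈ convexHull ℝ (toReal '' totalBundles u)) :
    ∃ (p : Fin n → ℝ) (q : Fin J → Fin n → ℝ),
      (∀ j, q j ∈ convexHull ℝ (toReal '' (u j).demand p)) ∧ ∑ j, q j = a := by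
  classical
  let P := {b : Fin J → Fin n → ℤ // b ∈ Fintype.piFinset fun j => (u j).bundles}
  have hrange : toReal '' totalBundles u = Set.range fun b : P => toReal (∑ j, b.1 j) := by
    ext z
    constructor
    · rintro ⟨_, ⟨b, hb, rfl⟩, rfl⟩
      exact ⟨⟨b, Fintype.mem_piFinset.2 hb⟩, rfl⟩
    · rintro ⟨b, rfl⟩
      exact ⟨_, ⟨b.1, Fintype.mem_piFinset.1 b.2, rfl⟩, rfl⟩
  rw [hrange] at ha
  obtain ⟨p, s, w, ⟨hw0, hw1⟩, hwa, hle, htight⟩ :=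
    exists_supporting_price _ (fun b : P => ∑ j, (u j).value (b.1 j)) a ha
  have hdem : ∀ b : P, w b ≠ 0 → ∀ j, b.1 j ∈ (u j).demand p := by
    intro b hb j
    refine ⟨Fintype.mem_piFinset.1 b.2 j, fun c hc => ?_⟩
    -- A tuple that is optimal in total is optimal for each agent: change one coordinate and cancel
    -- the other terms.
    have h1 := hle ⟨Function.update b.1 j c, Fintype.mem_piFinset.2 fun i => by
      rcases eq_or_ne i j with rfl | h
      · simpa using hc
      · simpa [h] using Fintype.mem_piFinset.1 b.2 i⟩
    rw [← htight b hb] at h1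
    simp only [toReal_sum, dotProduct_sum, ← Finset.sum_sub_distrib] at h1
    rw [← Finset.add_sum_erase _ _ (Finset.mem_univ j),
      ← Finset.add_sum_erase _ _ (Finset.mem_univ j)] at h1
    rw [Finset.sum_congr rfl fun i hi => by
      rw [Function.update_of_ne (Finset.ne_of_mem_erase hi)]] at h1
    simpa using h1
  refine ⟨p, fun j => ∑ b, w b • toReal (b.1 j), fun j => ?_, ?_⟩
  · have : ∑ b, w b • toReal (b.1 j) = ∑ b with w b ≠ 0, w b • toReal (b.1 j) := by
      rw [Finset.sum_filter_of_ne]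
      intro b _ h h0
      exact h (by rw [h0, zero_smul])
    beta_reduce
    rw [this]
    refine (convex_convexHull ℝ _).sum_mem (fun b _ => hw0 b)
      (by rw [Finset.sum_filter_ne_zero, hw1]) fun b hb => subset_convexHull ℝ _ ?_
    exact Set.mem_image_of_mem _ (hdem b (Finset.mem_filter.1 hb).2 j)
  · rw [Finset.sum_comm, ← hwa]
    simp only [toReal_sum, Finset.smul_sum]

/-- A fiber of the summation map on a finite product of compact convex sets contains a point from
which one cannot move in both directions. -/
theorem exists_rigid_decomposition {n J : ℕ} (K : Fin J → Set (Fin n → ℝ))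
    (hK : ∀ j, IsCompact (K j)) (a : Fin n → ℝ) (hne : ∃ q : Fin J → Fin n → ℝ,
      (∀ j, q j ∈ K j) ∧ ∑ j, q j = a) :
    ∃ q : Fin J → Fin n → ℝ, (∀ j, q j ∈ K j) ∧ ∑ j, q j = a ∧
      ∀ v : Fin J → Fin n → ℝ, ∑ j, v j = 0 → (∀ j, q j + v j ∈ K j) →
        (∀ j, q j - v j ∈ K j) → v = 0 := by
  have hcomp : IsCompact {q : Fin J → Fin n → ℝ | (∀ j, q j ∈ K j) ∧ ∑ j, q j = a} := by
    have := (isCompact_univ_pi hK).inter_right (isClosed_eq (f := fun q : Fin J → Fin n → ℝ =>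
      ∑ j, q j) (g := fun _ => a) (by fun_prop) continuous_const)
    convert this using 1
    ext q
    simp
  obtain ⟨q, hq⟩ := hcomp.extremePoints_nonempty hne
  rw [mem_extremePoints] at hq
  obtain ⟨⟨hqK, hqa⟩, hext⟩ := hq
  refine ⟨q, hqK, hqa, fun v hv hp hm => ?_⟩
  have h1 := (hext (q + v) ⟨hp, by simp [Finset.sum_add_distrib, hqa, hv]⟩
    (q - v) ⟨hm, by simp [Finset.sum_sub_distrib, hqa, hv]⟩
    ⟨1 / 2, 1 / 2, by norm_num, by norm_num, by norm_num, by
      rw [← smul_add, add_add_sub_cancel, ← two_smul ℝ q, smul_smul]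
      norm_num⟩).1
  simpa using h1

/-- Allows step lengths that depend on the agent and the sign to be replaced by one common length.
-/
theorem Convex.add_smul_mem_of_le {V : Type*} [AddCommGroup V] [Module ℝ V] {K : Set V}
    (hK : Convex ℝ K) {q v : V} {ε δ : ℝ} (hq : q ∈ K) (hε : 0 < ε) (hv : q + ε • v ∈ K)
    (hδ : 0 ≤ δ) (hδε : δ ≤ ε) : q + δ • v ∈ K := by
  have := hK.add_smul_mem hq hv (t := δ / ε) ⟨by positivity, (div_le_one hε).2 hδε⟩
  rwa [smul_smul, div_mul_cancel₀ _ hε.ne'] at this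

/-- Unimodular demand types guarantee competitive equilibrium. -/
theorem IsUnimodular.hasEquilibrium {n J : ℕ} {D : Set (Fin n → ℤ)} (hD : IsUnimodular D)
    (u : Fin J → Utility n) (hu : ∀ j, (u j).IsConcave ∧ (u j).IsOfDemandType D) :
    HasEquilibrium u := by
  intro a ha
  obtain ⟨p, hp⟩ := exists_price_convexHull_demand u ha
  simp only [Utility.demand_eq_cell] at hp
  obtain ⟨q, hqK, hqa, hrigid⟩ := exists_rigid_decomposition _
    (fun j => (((u j).cell_finite (-p)).image toReal).isCompact_convexHull (𝕜 := ℝ)) (toReal a) hp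
  choose x hsub hne hrel using fun j => (u j).exists_cell_relint (-p) (q j) (hqK j)
  choose b hb using hne
  let L : Fin J → Submodule ℝ (Fin n → ℝ) := fun j => direction ((u j).cell (x j))
  let T : Fin J → Set (Fin n → ℤ) := fun j => {v ∈ D | toReal v ∈ L j}
  have hmono : ∀ j, convexHull ℝ (toReal '' (u j).cell (x j)) ⊆
      convexHull ℝ (toReal '' (u j).cell (-p)) := fun j =>
    convexHull_mono (Set.image_mono (hsub j))
  have hL : ∀ j, L j = Submodule.span ℝ (toReal '' T j) := fun j =>
    Utility.direction_cell_eq_span (hu j).2 (x j)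
  have hqL : ∀ j, q j - toReal (b j) ∈ L j := by
    intro j
    obtain ⟨ε, -, hε⟩ := hrel j 0 (Submodule.zero_mem _)
    rw [smul_zero, add_zero] at hε
    have h1 := convexHull_subset_affineSpan (𝕜 := ℝ) _ hε
    exact AffineSubspace.vsub_mem_direction h1
      (subset_affineSpan ℝ _ (Set.mem_image_of_mem _ (hb j))) |> fun h => by
        rwa [direction_affineSpan] at h
  -- A relation among the `L j`, scaled down, would move `q` both ways inside the hulls without
  -- changing the sum, against rigidity.
  have hindep : ∀ v : Fin J → Fin n → ℝ, (∀ j, v j ∈ L j) → ∑ j, v j = 0 → v = 0 := by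
    intro v hvL hv
    choose ε hε hεmem using fun j => hrel j (v j) (hvL j)
    choose ε' hε' hεmem' using fun j => hrel j (-v j) (Submodule.neg_mem _ (hvL j))
    obtain ⟨δ, hδ, hδε⟩ : ∃ δ : ℝ, 0 < δ ∧ ∀ j, δ ≤ ε j ∧ δ ≤ ε' j := by
      have : ∀ᶠ δ : ℝ in nhdsWithin 0 (Set.Ioi 0), ∀ j, δ ≤ ε j ∧ δ ≤ ε' j := by
        rw [Filter.eventually_all]
        intro j
        refine Filter.Eventually.filter_mono nhdsWithin_le_nhds ?_
        exact (eventually_le_nhds (hε j)).and (eventually_le_nhds (hε' j))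
      obtain ⟨δ, h1, h2⟩ := (this.and self_mem_nhdsWithin).exists
      exact ⟨δ, h2, h1⟩
    have h0 := hrigid (δ • v) (by simp [← Finset.smul_sum, hv]) (fun j => ?_) fun j => ?_
    · exact (smul_eq_zero.1 h0).resolve_left hδ.ne'
    · exact Convex.add_smul_mem_of_le (convex_convexHull ℝ _) (hqK j) (hε j)
        (hmono j (hεmem j)) hδ.le (hδε j).1
    · have := Convex.add_smul_mem_of_le (convex_convexHull ℝ _) (hqK j) (hε' j)
        (hmono j (hεmem' j)) hδ.le (hδε j).2
      rwa [smul_neg, ← sub_eq_add_neg] at this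
  have hspan : a - ∑ j, b j ∈ Submodule.span ℤ (⋃ j, T j) := by
    refine hD.mem_span (Set.iUnion_subset fun j => Set.sep_subset _ _) ?_
    rw [toReal_sub, toReal_sum, ← hqa, ← Finset.sum_sub_distrib]
    refine Submodule.sum_mem _ fun j _ => ?_
    have h1 := hqL j
    rw [hL] at h1
    exact Submodule.span_mono (Set.image_mono (Set.subset_iUnion T j)) h1
  rw [Submodule.span_iUnion, Submodule.mem_iSup_iff_exists_finsupp] at hspan
  obtain ⟨w, hwT, hw⟩ := hspan
  rw [Finsupp.sum_fintype _ _ fun _ => rfl] at hw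
  have hwL : ∀ j, toReal (w j) ∈ L j := by
    intro j
    have h1 : toRealHom n (w j) ∈ Submodule.map (toRealHom n) (Submodule.span ℤ (T j)) :=
      Submodule.mem_map_of_mem (hwT j)
    rw [Submodule.map_span] at h1
    have h2 : Submodule.span ℤ (toRealHom n '' T j) ≤ (L j).restrictScalars ℤ := by
      rw [Submodule.span_le]
      rintro _ ⟨v, hv, rfl⟩
      exact hv.2
    exact h2 h1
  -- Both `q j - toReal (b j)` and `toReal (w j)` lie in `L j` and have the same total, so they
  -- agree for each agent.
  have hzero := hindep (fun j => q j - toReal (b j) - toReal (w j))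
    (fun j => Submodule.sub_mem _ (hqL j) (hwL j)) (by
      simp only [Finset.sum_sub_distrib, ← toReal_sum, hqa]
      rw [hw, toReal_sub, sub_self])
  have hq : ∀ j, q j = toReal (b j + w j) := fun j => by
    have h1 := congrFun hzero j
    rw [Pi.zero_apply, sub_sub, sub_eq_zero] at h1
    rw [h1, toReal_add]
  refine ⟨p, fun j => b j + w j, fun j => ?_, ?_⟩
  · rw [Utility.demand_eq_cell]
    exact (hu j).1.mem_cell_of_mem_convexHull (hq j ▸ hqK j)
  · rw [Finset.sum_add_distrib, hw, add_sub_cancel]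

/-! ### Equilibrium implies unimodularity -/

/-- The utility function that vanishes on the two bundles `0` and `s`. -/
def segmentUtility {n : ℕ} (s : Fin n → ℤ) : Utility n := ⟨{0, s}, 0⟩

/-- The only lattice points of the segment from `0` to a primitive vector are its end points. -/
theorem IsPrimitive.segmentUtility_isConcave {n : ℕ} {s : Fin n → ℤ} (hs : IsPrimitive s) :
    (segmentUtility s).IsConcave := by
  refine ⟨fun a ha => ?_, fun a ha => ⟨0, ha, fun b _ => by simp [segmentUtility]⟩⟩
  have h0 : toReal (0 : Fin n → ℤ) = 0 := (toRealHom n).map_zero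
  simp only [segmentUtility, Finset.coe_insert, Finset.coe_singleton, Set.image_pair,
    convexHull_pair, h0] at ha
  rw [segment_eq_image'] at ha
  obtain ⟨t, ⟨ht0, ht1⟩, hta⟩ := ha
  simp only [zero_add, sub_zero] at hta
  have hi : ∀ i, t * (s i : ℝ) = a i := fun i => congrFun hta i
  -- Bézout coefficients recover `t` from the integer vector `t • s`, so `t` is an integer in `[0,
  -- 1]`.
  obtain ⟨c, hc⟩ : ∃ c : Fin n → ℤ, Finset.univ.gcd s = ∑ i, s i * c i :=
    Finset.gcd_eq_sum_mul _ _
  have ht : t = ((∑ i, a i * c i : ℤ) : ℝ) := by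
    have h1 : ((∑ i, s i * c i : ℤ) : ℝ) = 1 := by
      rw [← hc, show Finset.univ.gcd s = 1 from hs, Int.cast_one]
    push_cast at h1 ⊢
    simp only [← hi, mul_assoc, ← Finset.mul_sum, h1, mul_one]
  set m := ∑ i, a i * c i with hm
  rw [ht] at ht0 ht1
  have h1 : 0 ≤ m := by exact_mod_cast ht0
  have h2 : m ≤ 1 := by exact_mod_cast ht1
  have ham : a = m • s := by
    ext i
    have := hi i
    rw [ht] at this
    simp only [Pi.smul_apply, smul_eq_mul]
    exact_mod_cast this.symm
  interval_cases m
  · simp [segmentUtility, ham]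
  · simp [segmentUtility, ham]

theorem segmentUtility_isOfDemandType {n : ℕ} {D : Set (Fin n → ℤ)} {s : Fin n → ℤ} (hs : s ∈ D) :
    (segmentUtility s).IsOfDemandType D := by
  rintro _ ⟨⟨x, rfl⟩, hfr⟩
  have h0 : toReal (0 : Fin n → ℤ) = 0 := (toRealHom n).map_zero
  refine ⟨s, hs, Submodule.eq_of_le_of_finrank_le ?_ ?_⟩
  · refine (direction_mono ((segmentUtility s).cell_subset x)).trans ?_
    simp only [direction, segmentUtility, Finset.coe_insert, Finset.coe_singleton, Set.image_pair,
      h0, vectorSpan_pair_rev, vsub_eq_sub, sub_zero]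
    exact le_rfl
  · rw [hfr]
    simpa using finrank_span_le_card (R := ℝ) ({toReal s} : Set (Fin n → ℝ))

theorem totalBundles_segmentUtility_subset {n J : ℕ} (s : Fin J → Fin n → ℤ) :
    totalBundles (fun j => segmentUtility (s j)) ⊆ Submodule.span ℤ (Set.range s) := by
  rintro _ ⟨b, hb, rfl⟩
  refine Submodule.sum_mem _ fun j _ => ?_
  have := hb j
  simp only [segmentUtility, Finset.mem_insert, Finset.mem_singleton] at this
  rcases this with h | h
  · rw [h]
    exact Submodule.zero_mem _
  · rw [h]
    exact Submodule.subset_span ⟨j, rfl⟩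

/-- The zonotope of a family of lattice vectors is contained in the convex hull of the sums of its
subfamilies. -/
theorem sum_smul_mem_convexHull_totalBundles {n J : ℕ} (s : Fin J → Fin n → ℤ) (t : Fin J → ℝ)
    (ht0 : ∀ j, 0 ≤ t j) (ht1 : ∀ j, t j ≤ 1) :
    ∑ j, t j • toReal (s j) ∈
      convexHull ℝ (toReal '' totalBundles (fun j => segmentUtility (s j))) := by
  -- Taking convex hulls commutes with Minkowski sums, which reduces the claim to single segments.
  have hset : toReal '' totalBundles (fun j => segmentUtility (s j)) =
      ∑ j, toReal '' ((segmentUtility (s j)).bundles : Set (Fin n → ℤ)) := by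
    ext z
    rw [Set.mem_finsetSum]
    constructor
    · rintro ⟨_, ⟨b, hb, rfl⟩, rfl⟩
      exact ⟨fun j => toReal (b j), fun {j} _ => Set.mem_image_of_mem _ (hb j),
        (toReal_sum _ _).symm⟩
    · rintro ⟨g, hg, rfl⟩
      choose b hb hbg using fun j => hg (Finset.mem_univ j)
      exact ⟨_, ⟨b, hb, rfl⟩, by rw [toReal_sum]; simp only [hbg]⟩
  rw [hset, convexHull_sum, Set.mem_finsetSum]
  refine ⟨fun j => t j • toReal (s j), fun {j} _ => ?_, rfl⟩
  have h0 : toReal (0 : Fin n → ℤ) = 0 := (toRealHom n).map_zero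
  simp only [segmentUtility, Finset.coe_insert, Finset.coe_singleton, Set.image_pair,
    convexHull_pair, h0]
  rw [segment_eq_image']
  exact ⟨t j, ⟨ht0 j, ht1 j⟩, by simp⟩

/-- If competitive equilibrium always exists, then the demand type is unimodular. -/
theorem isUnimodular_of_hasEquilibrium {n : ℕ} {D : Set (Fin n → ℤ)}
    (hD : ∀ v ∈ D, IsPrimitive v)
    (h : ∀ (J : ℕ) (u : Fin J → Utility n),
      (∀ j, (u j).IsConcave ∧ (u j).IsOfDemandType D) → HasEquilibrium u) :
    IsUnimodular D := by
  intro S hSD hS w hw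
  have hfin : Finite S := hS.finite
  obtain ⟨J, ⟨e⟩⟩ := Finite.exists_equiv_fin S
  let s : Fin J → Fin n → ℤ := fun j => (e.symm j).1
  have hsS : Set.range s = S := by
    rw [show s = Subtype.val ∘ e.symm from rfl, e.symm.surjective.range_comp,
      Subtype.range_coe]
  rw [← hsS, ← Set.range_comp, Submodule.mem_span_range_iff_exists_fun] at hw
  obtain ⟨c, hc⟩ := hw
  have hrange : ∀ j, s j ∈ Submodule.span ℤ S := fun j =>
    Submodule.subset_span (e.symm j).2
  -- Removing integer parts changes `w` only by an element of the integer span of `S` and puts it in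
  -- the zonotope.
  have hfrac : toReal (w - ∑ j, ⌊c j⌋ • s j) = ∑ j, Int.fract (c j) • toReal (s j) := by
    rw [toReal_sub, toReal_sum, ← hc, ← Finset.sum_sub_distrib]
    refine Finset.sum_congr rfl fun j _ => ?_
    rw [toReal_zsmul, ← Int.self_sub_floor, sub_smul]
    rfl
  obtain ⟨p, b, hb, hba⟩ := h J (fun j => segmentUtility (s j))
    (fun j => ⟨(hD _ (hSD (e.symm j).2)).segmentUtility_isConcave,
      segmentUtility_isOfDemandType (hSD (e.symm j).2)⟩) (w - ∑ j, ⌊c j⌋ • s j) (by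
        rw [hfrac]
        exact sum_smul_mem_convexHull_totalBundles s _ (fun j => Int.fract_nonneg _)
          fun j => (Int.fract_lt_one _).le)
  have hmem : w - ∑ j, ⌊c j⌋ • s j ∈ Submodule.span ℤ S := by
    have := totalBundles_segmentUtility_subset s ⟨b, fun j => (hb j).1, hba⟩
    rwa [hsS] at this
  have h1 := Submodule.add_mem _ hmem (Submodule.sum_mem _ fun j (_ : j ∈ Finset.univ) =>
    Submodule.smul_mem _ ⌊c j⌋ (hrange j))
  rwa [sub_add_cancel] at h1

/-! ### Reduction to bases -/

/-- For a spanning set, unimodularity only has to be checked on bases. -/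
theorem isUnimodular_iff_everyBasisSpans {n : ℕ} {D : Set (Fin n → ℤ)}
    (hD : Submodule.span ℝ (toReal '' D) = ⊤) : IsUnimodular D ↔ EveryBasisSpans D := by
  constructor
  · intro h S hSD hcard hS
    refine eq_top_iff.2 fun w _ => h S hSD hS w ?_
    have hfin : Finite S := hS.finite
    have := Fintype.ofFinite S
    have hc : Fintype.card S = Module.finrank ℝ (Fin n → ℝ) := by
      rw [Module.finrank_fin_fun, ← Nat.card_eq_fintype_card, Nat.card_coe_set_eq,
        Set.ncard, hcard, ENat.toNat_natCast]
    have htop := hS.span_eq_top_of_card_eq_finrank' hc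
    rw [Set.image_eq_range, htop]
    trivial
  · intro h S hSD hS w hw
    have hind : LinearIndepOn ℝ id (toReal '' S) := by
      have : LinearIndepOn ℝ toReal S := hS
      exact this.id_image
    -- Extend `S` to a basis inside `D`. There `w` has integer coefficients; by uniqueness they are
    -- its real coefficients over `S`, hence supported on `S`.
    obtain ⟨B, hBD, hSB, hDB, hB⟩ := exists_linearIndepOn_id_extension hind (Set.image_mono hSD)
    have hBT : toReal '' (toReal ⁻¹' B ∩ D) = B := by
      rw [Set.image_preimage_inter, Set.inter_eq_left.2 hBD]
    set S' := toReal ⁻¹' B ∩ D with hS'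
    have hS'ind : IsIndependent S' := by
      have : Function.Injective fun v : S' => (⟨toReal v.1, v.2.1⟩ : B) :=
        fun a b h => Subtype.ext (toReal_injective (congrArg Subtype.val h))
      exact LinearIndependent.comp hB _ this
    have htop : Submodule.span ℝ (toReal '' S') = ⊤ := by
      rw [hBT, eq_top_iff, ← hD]
      exact Submodule.span_le.2 hDB
    have hfin : Finite S' := hS'ind.finite
    have := Fintype.ofFinite S'
    have hcard : S'.encard = n := by
      have h1 := finrank_span_eq_card hS'ind
      rw [← Set.image_eq_range, htop, finrank_top, Module.finrank_fin_fun] at h1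
      exact (Set.coe_fintypeCard _).symm.trans (congrArg _ h1.symm)
    have hwS' : w ∈ Submodule.span ℤ S' := by
      rw [h S' Set.inter_subset_right hcard hS'ind]
      trivial
    have hSS' : S ⊆ S' := fun v hv => ⟨hSB (Set.mem_image_of_mem _ hv), hSD hv⟩
    rw [← Set.image_id S', Finsupp.mem_span_image_iff_linearCombination] at hwS'
    obtain ⟨c, hcS', hcw⟩ := hwS'
    have hwS := hw
    rw [Finsupp.mem_span_image_iff_linearCombination] at hwS
    obtain ⟨d, hdS, hdw⟩ := hwS
    have hcR : Finsupp.linearCombination ℝ toReal (c.mapRange (Int.cast : ℤ → ℝ) Int.cast_zero) =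
        toReal w := by
      rw [← hcw, Finsupp.linearCombination_apply, Finsupp.linearCombination_apply,
        Finsupp.sum_mapRange_index (by simp), Finsupp.sum, Finsupp.sum, toReal_sum]
      simp only [toReal_zsmul, id]
    have heq : c.mapRange (Int.cast : ℤ → ℝ) Int.cast_zero = d := by
      have hli : LinearIndepOn ℝ toReal S' := hS'ind
      refine linearIndepOn_iffₛ.1 hli _ ?_ _ ?_ (hcR.trans hdw.symm)
      · exact (Finset.coe_subset.2 Finsupp.support_mapRange).trans hcS'
      · exact Finsupp.supported_mono hSS' hdS
    rw [← hcw, Finsupp.linearCombination_apply]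
    refine Submodule.sum_mem _ fun v hv => Submodule.smul_mem _ _ (Submodule.subset_span ?_)
    refine hdS ?_
    rw [← heq]
    simpa using hv

end ProductMix

theorem mainTheorem1 (n : ℕ) (D : Set (Fin n → ℤ)) (hD : ∀ v ∈ D, ProductMix.IsPrimitive v) :
    (ProductMix.IsUnimodular D ↔
      ∀ (J : ℕ) (u : Fin J → ProductMix.Utility n),
        (∀ j, (u j).IsConcave ∧ (u j).IsOfDemandType D) → ProductMix.HasEquilibrium u) ∧
    (Submodule.span ℝ (ProductMix.toReal '' D) = ⊤ →
      (ProductMix.EveryBasisSpans D ↔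
        ∀ (J : ℕ) (u : Fin J → ProductMix.Utility n),
          (∀ j, (u j).IsConcave ∧ (u j).IsOfDemandType D) → ProductMix.HasEquilibrium u)) := by
  have h : ProductMix.IsUnimodular D ↔
      ∀ (J : ℕ) (u : Fin J → ProductMix.Utility n),
        (∀ j, (u j).IsConcave ∧ (u j).IsOfDemandType D) → ProductMix.HasEquilibrium u :=
    ⟨fun h _ u hu => h.hasEquilibrium u hu, ProductMix.isUnimodular_of_hasEquilibrium hD⟩
  exact ⟨h, fun hspan => (ProductMix.isUnimodular_iff_everyBasisSpans hspan).symm.trans h⟩
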